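/- Fix $\sigma>0$ and for every $n$ let $\Lambda_0[n]\subset\mathbb R^n$ be a full-rank lattice, with density $\beta=\beta[n]=1/\det\Lambda_0[n]$, normalized log-density $\delta=\delta[n]=\frac1n\log\beta$, nonzero distances $0<\lambda_1<\lambda_2<\dots$ and $\mathcal N_j$ lattice points of norm $\lambda_j$. Let $N=\sum_{j\ge1}\mathcal N_j\,\delta_{e^{\delta}\lambda_j}$ (a sum of Dirac masses) be the distance spectrum of the lattice normalized to determinant one, and let $V_n$ be the volume of the unit ball of $\mathbb R^n$. For $r>0$ the deterministic Minkowski–Hlawka–Siegel (DMHS) factor at radius $r$ is $$\alpha(r)=\min_{N'}\ \max_{x\le 2re^{\delta}}\alpha_{N'}(x),\qquad \alpha_{N'}(x)=\frac{N'(x)}{nV_nx^{n-1}}\ (x>0),\quad \alpha_{N'}(x)=0\ (x\le 0),$$ where $N'$ ranges over the nonnegative integrable functions on $(0,2re^{\delta}]$ with $N((0,s])\le\int_0^sN'(x)\,dx$ for all $s\in(0,2re^{\delta}]$ (max and min are read as supremum and infimum). A point of $\Lambda_0[n]$ is sent over the channel $\mathbf y=\boldsymbol\lambda+\mathbf z$,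 where $\mathbf z$ is a Gaussian vector with independent centred coordinates of variance $\sigma^2$; let $f_{\|\mathbf z\|}$ be the density of $\|\mathbf z\|$. For each $n\ge1$ let $r[n]>0$ be a radius which either minimizes over all $r>0$ the DMHS bound $$\alpha(r)\,\beta V_n\int_0^r f_{\|\mathbf z\|}(\rho)\rho^n\,d\rho+\int_r^\infty f_{\|\mathbf z\|}(\rho)\,d\rho,$$ or satisfies $\alpha(r[n])\,\beta V_n\,r[n]^n\ge1$ (for instance, the stationarity condition $r[n]=(\alpha(r[n])\beta V_n)^{-1/n}$). Put $\alpha[n]=\alpha(r[n])$ and $\nu[n]=\frac1n\log\alpha[n]$. Then the error probability of a maximum-likelihood decoder satisfies, for all $n\ge1$, $$P_e(\Lambda_0[n])\le e^{-n\left(E_r(\delta+\nu[n])+o(1)\right)},\qquad o(1)\to0\ \text{ as } n\to\infty,$$ for every transmitted lattice point and every way of breaking ties in the decoder, the $o(1)$ being the same for all of them. Here $$E_r(\delta)=\begin{cases}(\delta^*-\delta)+\frac12\log\frac e4,&\delta\le\delta_{cr},\\[2pt] \frac12\left(e^{2(\delta^*-\delta)}-2(\delta^*-\delta)-1\right),&\delta_{cr}\le\delta<\delta^*,\\[2pt]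 0,&\delta\ge\delta^*,\end{cases}$$ $$\delta^*=\tfrac12\log\frac1{2\pi e\sigma^2},\qquad \delta_{cr}=\tfrac12\log\frac1{4\pi e\sigma^2}.$$ -/

import Mathlib

open MeasureTheory Set Filter Topology
open scoped ENNReal

noncomputable section

namespace LatticeAWGN

/-- Euclidean `n`-space. -/
abbrev Space (n : ℕ) : Type := EuclideanSpace ℝ (Fin n)

/-! ### Lattices and their distance spectrum -/

/-- `V_n`, the volume of the unit ball of `ℝⁿ`. -/
def unitBallVolume (n : ℕ) : ℝ := volume.real (Metric.ball (0 : Space n) 1)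

/-- The density `β = (det Λ)⁻¹`; the covolume is the volume of a fundamental parallelepiped. -/
def density {n : ℕ} (L : Submodule ℤ (Space n)) : ℝ := (ZLattice.covolume L volume)⁻¹

/-- The normalized log-density `δ`, so that `β = e^{nδ}`. -/
def nld {n : ℕ} (L : Submodule ℤ (Space n)) : ℝ := (1 / (n : ℝ)) * Real.log (density L)

/-- The set `{λ_1, λ_2, …}` of norms of the nonzero points of the lattice. -/
def distances {n : ℕ} (L : Submodule ℤ (Space n)) : Set ℝ :=
  (fun v : Space n => ‖v‖) '' {v | v ∈ L ∧ v ≠ 0}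

/-- The number of lattice points of norm `d`; this is `𝒩_j` for `d = λ_j`. -/
def multiplicity {n : ℕ} (L : Submodule ℤ (Space n)) (d : ℝ) : ℕ :=
  {v : Space n | v ∈ L ∧ ‖v‖ = d}.ncard

/-- The normalized distance spectrum `N = ∑_j 𝒩_j δ_{e^δ λ_j}`, a sum of Dirac masses at the
norms `e^δ λ_j` of the lattice rescaled to determinant one. -/
def distanceSpectrum {n : ℕ} (L : Submodule ℤ (Space n)) : Measure ℝ :=
  Measure.sum fun d : distances L =>
    (multiplicity L (d : ℝ) : ℝ≥0∞) • Measure.dirac (Real.exp (nld L) * (d : ℝ))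

/-! ### The deterministic Minkowski-Hlawka-Siegel factor -/

/-- `N'` is a smoothed version of the spectrum `N` on `(0, X]`: a nonnegative integrable density
with `∫_{0⁺}^s N ≤ ∫_{0⁺}^s N'` for all `s ∈ (0, X]`. -/
structure IsSmoothing {n : ℕ} (L : Submodule ℤ (Space n)) (X : ℝ) (N' : ℝ → ℝ) : Prop where
  nonneg : ∀ x ∈ Ioc 0 X, 0 ≤ N' x
  integrable : IntegrableOn N' (Ioc 0 X)
  dominates : ∀ s ∈ Ioc 0 X,
    distanceSpectrum L (Ioc 0 s) ≤ ENNReal.ofReal (∫ x in Ioc 0 s, N' x)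

/-- `α(x) = N'(x) / (n V_n x^{n-1})` for `x > 0`, and `α(x) = 0` for `x ≤ 0`. -/
def alphaOf (n : ℕ) (N' : ℝ → ℝ) (x : ℝ) : ℝ :=
  if 0 < x then N' x / (n * unitBallVolume n * x ^ (n - 1)) else 0

/-- The factor `max_{x ≤ 2 r e^δ} α^opt(x)`, where `α^opt` minimizes `max_{x ≤ 2 r e^δ} α(x)`
among the functions `α` that come from smoothed spectra on `(0, 2 r e^δ]`. -/
def dmhsFactor {n : ℕ} (L : Submodule ℤ (Space n)) (r : ℝ) : ℝ :=
  sInf {M : ℝ | ∃ N' : ℝ → ℝ, IsSmoothing L (Real.exp (nld L) * (2 * r)) N' ∧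
    IsLUB (alphaOf n N' '' Iic (Real.exp (nld L) * (2 * r))) M}

/-! ### The AWGN channel and maximum-likelihood decoding -/

/-- The density of white Gaussian noise with variance `σ²` per coordinate. -/
def noiseDensity (n : ℕ) (σ : ℝ) (z : Space n) : ℝ :=
  (2 * Real.pi * σ ^ 2) ^ (-((n : ℝ) / 2)) * Real.exp (-‖z‖ ^ 2 / (2 * σ ^ 2))

/-- The law of the noise vector. -/
def noise (n : ℕ) (σ : ℝ) : Measure (Space n) :=
  volume.withDensity fun z => ENNReal.ofReal (noiseDensity n σ z)

/-- The law `f_{‖z‖}(ρ) dρ` of the norm of the noise vector. -/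
def noiseNorm (n : ℕ) (σ : ℝ) : Measure ℝ := (noise n σ).map fun z => ‖z‖

/-- `D` is a maximum-likelihood decoder for the lattice: it maps every received vector `y` to a
lattice point that maximizes the likelihood of `y` (ties are broken arbitrarily). -/
def IsMLDecoder {n : ℕ} (L : Submodule ℤ (Space n)) (σ : ℝ) (D : Space n → Space n) : Prop :=
  ∀ y, D y ∈ L ∧ ∀ v ∈ L, noiseDensity n σ (y - v) ≤ noiseDensity n σ (y - D y)

/-- The probability that the decoder `D` errs when `x` is transmitted. -/
def errorProb {n : ℕ} (σ : ℝ) (D : Space n → Space n) (x : Space n) : ℝ≥0∞ :=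
  noise n σ {z | D (x + z) ≠ x}

/-! ### The radius -/

/-- The upper bound on the error probability with radius `r`:
`α β V_n ∫_0^r f_{‖z‖}(ρ) ρ^n dρ + ∫_r^∞ f_{‖z‖}(ρ) dρ`, where `α` depends on `r`. -/
def dmhsBound {n : ℕ} (L : Submodule ℤ (Space n)) (σ r : ℝ) : ℝ :=
  dmhsFactor L r * density L * unitBallVolume n * (∫ ρ in Ioc 0 r, ρ ^ n ∂(noiseNorm n σ)) +
    (noiseNorm n σ).real (Ioi r)

/-- Radii at which the factor `α` may be taken: those that minimize the bound over all `r > 0`,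
and those with `r ≥ (α β V_n)^{-1/n}`, where `α` is the factor at `r` itself. Equality here is the
stationarity condition `r = (α β V_n)^{-1/n}`. -/
def IsDMHSRadius {n : ℕ} (L : Submodule ℤ (Space n)) (σ r : ℝ) : Prop :=
  0 < r ∧ (IsMinOn (dmhsBound L σ) (Ioi 0) r ∨
    1 ≤ dmhsFactor L r * density L * unitBallVolume n * r ^ n)

/-! ### The random-coding exponent -/

/-- `δ*`, the largest normalized log-density at which the exponent can be positive. -/
def deltaStar (σ : ℝ) : ℝ := 1 / 2 * Real.log (1 / (2 * Real.pi * Real.exp 1 * σ ^ 2))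

/-- The critical normalized log-density `δ_cr`. -/
def deltaCr (σ : ℝ) : ℝ := 1 / 2 * Real.log (1 / (4 * Real.pi * Real.exp 1 * σ ^ 2))

/-- Poltyrev's random-coding exponent `E_r(δ)` for noise variance `σ²`. -/
def randomCodingExponent (σ δ : ℝ) : ℝ :=
  if δ ≤ deltaCr σ then (deltaStar σ - δ) + 1 / 2 * Real.log (Real.exp 1 / 4)
  else if δ < deltaStar σ then
    (Real.exp (2 * (deltaStar σ - δ)) - 2 * (deltaStar σ - δ) - 1) / 2
  else 0

end LatticeAWGN

end

namespace LatticeAWGN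

/-! ### The unit ball, the density and the distance spectrum -/

/-! The factor `α` at `r` is the supremum over `0 < s ≤ 2r` of the number of nonzero lattice points
of norm at most `s`, divided by `β V_n s^n`. So `encard_nonzeroBall_le` bounds every such count by
`αβ` times the volume of the ball. The probability that noise of norm at most `a` is at least as
close to `v` as to `0` decreases with `‖v‖` and vanishes for `‖v‖ > 2a`. For `a ≤ r`, comparing
superlevel sets therefore bounds the union bound over the lattice by `αβ` times an integral over
space, which Fubini computes. This gives the bound `E[αβV_n ‖z‖^n; ‖z‖ ≤ a] + P(‖z‖ > a)`. If `αβV_n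
r^n ≥ 1`, then `a` with `αβV_n a^n = 1` satisfies `a ≤ r`, and the bound becomes `E min(1,
(‖z‖/a)^n)`. For `s ∈ [0,1]` the integrand is at most `(‖z‖/a)^{ns}`, which is in turn at most an
exponential of `‖z‖²` with an explicit Gaussian mean. The right `s` gives exactly `E_r`, once `V_n ≤
(2πe/n)^{n/2}` is used; hence `o(1) = 0` works. A minimizing radius satisfies the same inequality:
otherwise enlarging it slightly lowers the bound (`one_le_of_isMinOn_dmhsBound`). -/

theorem unitBallVolume_pos (n : ℕ) : 0 < unitBallVolume n :=
  ENNReal.toReal_pos (Metric.measure_ball_pos volume _ one_pos).ne' measure_ball_lt_top.ne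

theorem volume_closedBall {n : ℕ} (x : Space n) {s : ℝ} (hs : 0 ≤ s) :
    volume (Metric.closedBall x s) = ENNReal.ofReal (unitBallVolume n * s ^ n) := by
  rw [Measure.addHaar_closedBall _ _ hs, finrank_euclideanSpace_fin, mul_comm,
    ENNReal.ofReal_mul (unitBallVolume_pos n).le, unitBallVolume, Measure.real,
    ENNReal.ofReal_toReal measure_ball_lt_top.ne]

variable {n : ℕ} (L : Submodule ℤ (Space n))

theorem density_pos [DiscreteTopology L] [IsZLattice ℝ L] : 0 < density L := inv_pos.2 (ZLattice.covolume_pos L volume)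

theorem exp_nld_pow [DiscreteTopology L] [IsZLattice ℝ L] (hn : 1 ≤ n) : Real.exp (nld L) ^ n = density L := by
  have : (n : ℝ) ≠ 0 := by positivity
  rw [← Real.exp_nat_mul, nld, ← mul_assoc, mul_one_div_cancel this, one_mul,
    Real.exp_log (density_pos L)]

/-- The nonzero lattice points of norm at most `s`. -/
def nonzeroBall {n : ℕ} (L : Submodule ℤ (Space n)) (s : ℝ) : Set (Space n) :=
  {v | v ∈ L ∧ v ≠ 0 ∧ ‖v‖ ≤ s}

theorem finite_inter_closedBall [DiscreteTopology L] (s : ℝ) : {v : Space n | v ∈ L ∧ ‖v‖ ≤ s}.Finite := by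
  have : DiscreteTopology L.toAddSubgroup := (inferInstance : DiscreteTopology L)
  have h := Metric.finite_isBounded_inter_isClosed (s := (L : Set (Space n)))
    (K := Metric.closedBall 0 s) DiscreteTopology.isDiscrete Metric.isBounded_closedBall
    (AddSubgroup.isClosed_of_discrete (H := L.toAddSubgroup))
  refine h.subset fun v hv => ⟨by simpa using hv.2, hv.1⟩

theorem finite_nonzeroBall [DiscreteTopology L] (s : ℝ) : (nonzeroBall L s).Finite :=
  (finite_inter_closedBall L s).subset fun _ hv => ⟨hv.1, hv.2.2⟩

theorem distanceSpectrum_Ioc [DiscreteTopology L] (s : ℝ) :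
    distanceSpectrum L (Ioc 0 (Real.exp (nld L) * s)) = ((nonzeroBall L s).encard : ℝ≥0∞) := by
  classical
  let S : Set (Space n) := {v | v ∈ L ∧ v ≠ 0}
  let g : S → distances L := fun v => ⟨‖(v : Space n)‖, v, v.2, rfl⟩
  let f : Space n → ℝ≥0∞ := (Metric.closedBall (0 : Space n) s).indicator 1
  -- Each weighted Dirac mass is the sum over the fibre of lattice points of that norm; summing over
  -- fibres recovers the point count.
  have key : ∀ d : distances L,
      ((multiplicity L (d : ℝ) : ℝ≥0∞) • Measure.dirac (Real.exp (nld L) * (d : ℝ)))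
        (Ioc 0 (Real.exp (nld L) * s)) = ∑' b : g ⁻¹' {d}, f b := by
    rintro ⟨d, v₀, ⟨hv₀, hv₀'⟩, rfl⟩
    have hpos : 0 < ‖v₀‖ := norm_pos_iff.2 hv₀'
    have hf : ∀ b : g ⁻¹' {⟨‖v₀‖, v₀, ⟨hv₀, hv₀'⟩, rfl⟩}, f b = f v₀ := by
      rintro ⟨b, hb⟩
      have hb' : ‖(b : Space n)‖ = ‖v₀‖ := congrArg Subtype.val hb
      simp [f, indicator, hb']
    have hcard : ENat.card (g ⁻¹' {⟨‖v₀‖, v₀, ⟨hv₀, hv₀'⟩, rfl⟩}) = multiplicity L ‖v₀‖ := by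
      have hfin : {v : Space n | v ∈ L ∧ ‖v‖ = ‖v₀‖}.Finite :=
        (finite_inter_closedBall L ‖v₀‖).subset fun v hv => ⟨hv.1, hv.2.le⟩
      rw [multiplicity, hfin.cast_ncard_eq, ← ENat.card_coe_set_eq]
      refine ENat.card_congr ⟨fun b => ⟨b.1, b.1.2.1, congrArg Subtype.val b.2⟩,
        fun v => ⟨⟨v, v.2.1, ?_⟩, Subtype.ext v.2.2⟩, fun _ => rfl, fun _ => rfl⟩
      exact norm_pos_iff.1 (hpos.trans_eq v.2.2.symm)
    rw [tsum_congr hf, ENNReal.tsum_const, hcard]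
    have := Real.exp_pos (nld L)
    simp [f, indicator, hpos, this]
  rw [distanceSpectrum, Measure.sum_apply _ measurableSet_Ioc, tsum_congr key,
    ENNReal.tsum_fiberwise (fun v : S => f v) g, tsum_subtype S f, ← ENNReal.tsum_set_one,
    tsum_subtype (nonzeroBall L s) fun _ => (1 : ℝ≥0∞)]
  refine tsum_congr fun v => ?_
  by_cases h1 : v ∈ L <;> by_cases h2 : v = 0 <;> by_cases h3 : ‖v‖ ≤ s <;>
    simp [S, f, nonzeroBall, indicator, h1, h2, h3]

/-! ### The factor as the largest ratio of point counts to volumes -/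

theorem setIntegral_Ioc_pow (hn : 1 ≤ n) {c s : ℝ} (hs : 0 ≤ s) :
    ∫ x in Ioc 0 s, c * (n * unitBallVolume n * x ^ (n - 1)) =
      c * (unitBallVolume n * s ^ n) := by
  obtain ⟨m, rfl⟩ := Nat.exists_eq_succ_of_ne_zero (by omega : n ≠ 0)
  rw [← intervalIntegral.integral_of_le hs]
  have : ((m : ℝ) + 1) ≠ 0 := by positivity
  simp only [intervalIntegral.integral_const_mul, Nat.succ_eq_add_one, Nat.add_sub_cancel,
    integral_pow]
  push_cast
  field_simp
  simp

/-- The optimal smoothing has constant ratio `M`, so its integral up to `s` is `M V_n s^n`. -/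
theorem exists_smoothing_bound (hn : 1 ≤ n) {M X : ℝ} (hX : 0 < X) (hM : 0 ≤ M)
    (h : ∀ s ∈ Ioc 0 X,
      distanceSpectrum L (Ioc 0 s) ≤ ENNReal.ofReal (M * (unitBallVolume n * s ^ n))) :
    ∃ N' : ℝ → ℝ, IsSmoothing L X N' ∧ IsLUB (alphaOf n N' '' Iic X) M := by
  have hV := unitBallVolume_pos n
  have hn' : (0 : ℝ) < n := by positivity
  refine ⟨fun x => M * (n * unitBallVolume n * x ^ (n - 1)), ⟨fun x hx => ?_, ?_, fun s hs => ?_⟩,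
    ?_⟩
  · have := hx.1
    positivity
  · exact (Continuous.integrableOn_Icc (by fun_prop)).mono_set Ioc_subset_Icc_self
  · rw [setIntegral_Ioc_pow hn hs.1.le]
    exact h s hs
  · have hα : ∀ x, 0 < x → alphaOf n (fun x => M * (n * unitBallVolume n * x ^ (n - 1))) x = M := by
      intro x hx
      rw [alphaOf, if_pos hx]
      field_simp
    refine IsGreatest.isLUB ⟨⟨X, self_mem_Iic, hα X hX⟩, ?_⟩
    rintro _ ⟨x, -, rfl⟩
    by_cases hx : 0 < x
    · exact (hα x hx).le
    · rwa [alphaOf, if_neg hx]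

theorem nonneg_of_isLUB_alphaOf {N' : ℝ → ℝ} {X M : ℝ} (hX : 0 < X)
    (hM : IsLUB (alphaOf n N' '' Iic X) M) : 0 ≤ M :=
  hM.1 ⟨0, hX.le, by simp [alphaOf]⟩

theorem distanceSpectrum_le_of_smoothing (hn : 1 ≤ n) {N' : ℝ → ℝ} {X M s : ℝ}
    (hN : IsSmoothing L X N') (hM : IsLUB (alphaOf n N' '' Iic X) M) (hs : s ∈ Ioc 0 X) :
    distanceSpectrum L (Ioc 0 s) ≤ ENNReal.ofReal (M * (unitBallVolume n * s ^ n)) := by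
  have hV := unitBallVolume_pos n
  have hn' : (0 : ℝ) < n := by positivity
  refine (hN.dominates s hs).trans (ENNReal.ofReal_le_ofReal ?_)
  rw [← setIntegral_Ioc_pow hn hs.1.le]
  refine setIntegral_mono_on (hN.integrable.mono_set (Ioc_subset_Ioc_right hs.2))
    ((Continuous.integrableOn_Icc (by fun_prop)).mono_set Ioc_subset_Icc_self)
    measurableSet_Ioc fun x hx => ?_
  have h := hM.1 ⟨x, hx.2.trans hs.2, rfl⟩
  have hx0 := hx.1
  rwa [alphaOf, if_pos hx.1, div_le_iff₀ (by positivity)] at h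

theorem dmhsFactor_nonneg {r : ℝ} (hr : 0 < r) : 0 ≤ dmhsFactor L r :=
  Real.sInf_nonneg fun _ ⟨_, _, hM⟩ =>
    nonneg_of_isLUB_alphaOf (mul_pos (Real.exp_pos _) (by positivity)) hM

theorem normalized_volume [DiscreteTopology L] [IsZLattice ℝ L] (hn : 1 ≤ n) (M s : ℝ) :
    M * (unitBallVolume n * (Real.exp (nld L) * s) ^ n) =
      M * density L * unitBallVolume n * s ^ n := by
  rw [mul_pow, exp_nld_pow L hn]
  ring

theorem forall_Ioc_exp_nld_mul {X : ℝ} {P : ℝ → Prop}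
    (h : ∀ s ∈ Ioc 0 X, P (Real.exp (nld L) * s)) :
    ∀ s ∈ Ioc 0 (Real.exp (nld L) * X), P s := by
  intro s hs
  have he := Real.exp_pos (nld L)
  have := h (s / Real.exp (nld L)) ⟨div_pos hs.1 he, by
    rw [div_le_iff₀ he, mul_comm]
    exact hs.2⟩
  rwa [mul_div_cancel₀ _ he.ne'] at this

theorem mem_dmhsFactor_set [DiscreteTopology L] [IsZLattice ℝ L] (hn : 1 ≤ n) {M r : ℝ} (hr : 0 < r) (hM : 0 ≤ M)
    (h : ∀ s ∈ Ioc 0 (2 * r), ((nonzeroBall L s).encard : ℝ≥0∞) ≤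
      ENNReal.ofReal (M * density L * unitBallVolume n * s ^ n)) :
    ∃ N' : ℝ → ℝ, IsSmoothing L (Real.exp (nld L) * (2 * r)) N' ∧
      IsLUB (alphaOf n N' '' Iic (Real.exp (nld L) * (2 * r))) M := by
  refine exists_smoothing_bound L hn (mul_pos (Real.exp_pos _) (by positivity)) hM
    (forall_Ioc_exp_nld_mul L fun s hs => ?_)
  rw [distanceSpectrum_Ioc, normalized_volume L hn]
  exact h s hs

theorem dmhsFactor_le [DiscreteTopology L] [IsZLattice ℝ L] (hn : 1 ≤ n) {M r : ℝ} (hr : 0 < r) (hM : 0 ≤ M)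
    (h : ∀ s ∈ Ioc 0 (2 * r), ((nonzeroBall L s).encard : ℝ≥0∞) ≤
      ENNReal.ofReal (M * density L * unitBallVolume n * s ^ n)) :
    dmhsFactor L r ≤ M :=
  csInf_le ⟨0, fun _ ⟨_, _, hM⟩ =>
    nonneg_of_isLUB_alphaOf (mul_pos (Real.exp_pos _) (by positivity)) hM⟩
    (mem_dmhsFactor_set L hn hr hM h)

/-- Only finitely many norms lie in `(t, t + 1]`, so there is room before the next one. -/
theorem exists_nonzeroBall_gap [DiscreteTopology L] (t : ℝ) : ∃ t' > t, nonzeroBall L t' = nonzeroBall L t := by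
  have hfin : ((fun v : Space n => ‖v‖) '' nonzeroBall L (t + 1) ∩ Ioi t).Finite :=
    ((finite_nonzeroBall L _).image _).inter_of_left _
  have hev : ∀ᶠ x in 𝓝[>] t, ∀ d ∈ (fun v : Space n => ‖v‖) '' nonzeroBall L (t + 1) ∩ Ioi t,
      x < d :=
    (eventually_all_finite hfin).2 fun d hd => nhdsWithin_le_nhds (Iio_mem_nhds hd.2)
  have h1 : ∀ᶠ x in 𝓝[>] t, x < t + 1 := nhdsWithin_le_nhds (Iio_mem_nhds (by linarith))
  obtain ⟨x, hx, hx1, hxt⟩ := (hev.and (h1.and self_mem_nhdsWithin)).exists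
  refine ⟨x, hxt, Subset.antisymm (fun v hv => ⟨hv.1, hv.2.1, ?_⟩)
    fun v hv => ⟨hv.1, hv.2.1, hv.2.2.trans (le_of_lt hxt)⟩⟩
  by_contra! hlt
  exact absurd (hx ‖v‖ ⟨⟨v, ⟨hv.1, hv.2.1, hv.2.2.trans hx1.le⟩, rfl⟩, hlt⟩) (not_lt.2 hv.2.2)

theorem nonzeroBall_mono {s t : ℝ} (h : s ≤ t) : nonzeroBall L s ⊆ nonzeroBall L t :=
  fun _ hv => ⟨hv.1, hv.2.1, hv.2.2.trans h⟩

theorem nonzeroBall_zero : nonzeroBall L 0 = ∅ :=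
  eq_empty_of_forall_notMem fun _ hv => hv.2.1 (norm_le_zero_iff.1 hv.2.2)

/-- Makes the set defining `dmhsFactor` nonempty, so that its `sInf` is a genuine infimum and not
the default `0`. -/
theorem exists_encard_le [DiscreteTopology L] [IsZLattice ℝ L] (X : ℝ) : ∃ M : ℝ, 0 ≤ M ∧
    ∀ s ∈ Ioc 0 X, ((nonzeroBall L s).encard : ℝ≥0∞) ≤
      ENNReal.ofReal (M * density L * unitBallVolume n * s ^ n) := by
  obtain ⟨d, hd, hd0⟩ := exists_nonzeroBall_gap L 0
  rw [nonzeroBall_zero] at hd0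
  have hV := unitBallVolume_pos n
  have hβ := density_pos L
  have hd' : 0 < d := hd
  refine ⟨(nonzeroBall L X).ncard / (density L * unitBallVolume n * d ^ n), by positivity,
    fun s hs => ?_⟩
  rcases le_total s d with hsd | hsd
  · rw [subset_empty_iff.1 ((nonzeroBall_mono L hsd).trans hd0.subset)]
    simp
  · calc ((nonzeroBall L s).encard : ℝ≥0∞) ≤ ((nonzeroBall L X).encard : ℝ≥0∞) := by
          exact_mod_cast encard_le_encard (nonzeroBall_mono L hs.2)
      _ = ENNReal.ofReal ((nonzeroBall L X).ncard : ℝ) := by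
          rw [← (finite_nonzeroBall L X).cast_ncard_eq]
          simp
      _ ≤ _ := by
          refine ENNReal.ofReal_le_ofReal ?_
          have hpow : d ^ n ≤ s ^ n := by gcongr
          calc ((nonzeroBall L X).ncard : ℝ)
              = (nonzeroBall L X).ncard / (density L * unitBallVolume n * d ^ n) * density L *
                unitBallVolume n * d ^ n := by field_simp
            _ ≤ _ := by gcongr

theorem encard_nonzeroBall_le [DiscreteTopology L] [IsZLattice ℝ L] (hn : 1 ≤ n) {r s : ℝ} (hs : s ∈ Ioc 0 (2 * r)) :
    ((nonzeroBall L s).encard : ℝ≥0∞) ≤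
      ENNReal.ofReal (dmhsFactor L r * density L * unitBallVolume n * s ^ n) := by
  have hV := unitBallVolume_pos n
  have hβ := density_pos L
  have hs0 := hs.1
  have hr : 0 < r := by linarith [hs.1, hs.2]
  have hcard : ((nonzeroBall L s).encard : ℝ≥0∞) =
      ENNReal.ofReal ((nonzeroBall L s).ncard : ℝ) := by
    rw [← (finite_nonzeroBall L s).cast_ncard_eq]
    simp
  rw [hcard]
  refine ENNReal.ofReal_le_ofReal ?_
  have hc : 0 < density L * unitBallVolume n * s ^ n := by positivity
  rw [mul_assoc, mul_assoc, ← mul_assoc (density L), ← div_le_iff₀ hc]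
  obtain ⟨M₀, hM₀, hM₀'⟩ := exists_encard_le L (2 * r)
  refine le_csInf ⟨M₀, mem_dmhsFactor_set L hn hr hM₀ hM₀'⟩ ?_
  rintro M ⟨N', hN, hM⟩
  have he := Real.exp_pos (nld L)
  have hM0 := nonneg_of_isLUB_alphaOf (mul_pos he (by positivity)) hM
  have h := distanceSpectrum_le_of_smoothing L hn hN hM
    (s := Real.exp (nld L) * s) ⟨by positivity, by have := hs.2; gcongr⟩
  rw [distanceSpectrum_Ioc, normalized_volume L hn, hcard,
    ENNReal.ofReal_le_ofReal_iff (by positivity)] at h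
  rw [div_le_iff₀ hc]
  linarith

/-- The factor does not change while no lattice point enters the ball of radius `2 r`. -/
theorem dmhsFactor_le_of_nonzeroBall_eq [DiscreteTopology L] [IsZLattice ℝ L] (hn : 1 ≤ n) {r r' : ℝ} (hr : 0 < r) (hrr' : r ≤ r')
    (h : nonzeroBall L (2 * r') = nonzeroBall L (2 * r)) :
    dmhsFactor L r' ≤ dmhsFactor L r := by
  have hV := unitBallVolume_pos n
  have hβ := density_pos L
  have hα := dmhsFactor_nonneg L hr
  refine dmhsFactor_le L hn (hr.trans_le hrr') hα fun s hs => ?_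
  rcases le_total s (2 * r) with hsr | hsr
  · exact encard_nonzeroBall_le L hn ⟨hs.1, hsr⟩
  -- Past `2 * r` the count is frozen while the volume grows.
  · rw [Subset.antisymm ((nonzeroBall_mono L hs.2).trans h.subset) (nonzeroBall_mono L hsr)]
    refine (encard_nonzeroBall_le L hn ⟨by positivity, le_rfl⟩).trans
      (ENNReal.ofReal_le_ofReal ?_)
    gcongr

end LatticeAWGN

namespace LatticeAWGN

/-! ### Gaussian noise -/

section Noise

variable {n : ℕ} {σ : ℝ}

@[fun_prop]
theorem continuous_noiseDensity : Continuous (noiseDensity n σ) := by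
  unfold noiseDensity
  fun_prop

theorem noiseDensity_le_iff (hσ : 0 < σ) (y z : Space n) :
    noiseDensity n σ y ≤ noiseDensity n σ z ↔ ‖z‖ ≤ ‖y‖ := by
  have hc : 0 < (2 * Real.pi * σ ^ 2) ^ (-((n : ℝ) / 2)) := by positivity
  rw [noiseDensity, noiseDensity, mul_le_mul_iff_right₀ hc, Real.exp_le_exp,
    div_le_div_iff_of_pos_right (by positivity), neg_le_neg_iff,
    sq_le_sq₀ (norm_nonneg _) (norm_nonneg _)]

/-- The exponential moments of the squared norm of the noise. -/
theorem lintegral_noise_exp (hσ : 0 < σ) (c : ℝ) {θ : ℝ} (hθ : 2 * σ ^ 2 * θ < 1) :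
    ∫⁻ z, ENNReal.ofReal (Real.exp (c + θ * ‖z‖ ^ 2)) ∂(noise n σ) =
      ENNReal.ofReal (Real.exp (c - n / 2 * Real.log (1 - 2 * σ ^ 2 * θ))) := by
  have hd : 0 < 1 - 2 * σ ^ 2 * θ := by linarith
  have hb : 0 < (1 - 2 * σ ^ 2 * θ) / (2 * σ ^ 2) := by positivity
  set b := (1 - 2 * σ ^ 2 * θ) / (2 * σ ^ 2) with hb_def
  have hint : ∫ z : Space n, Real.exp (-b * ‖z‖ ^ 2) = (Real.pi / b) ^ ((n : ℝ) / 2) := by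
    rw [GaussianFourier.integral_rexp_neg_mul_sq_norm hb, finrank_euclideanSpace_fin]
  -- A non-integrable function has integral `0` by convention, but the value in `hint` is positive.
  have hI : Integrable fun z : Space n => Real.exp (-b * ‖z‖ ^ 2) := by
    by_contra h
    rw [integral_undef h] at hint
    have : 0 < (Real.pi / b) ^ ((n : ℝ) / 2) := by positivity
    exact this.ne hint
  rw [noise, lintegral_withDensity_eq_lintegral_mul _ (by fun_prop) (by fun_prop)]
  have hpt : ∀ z : Space n, ((fun z : Space n => ENNReal.ofReal (noiseDensity n σ z)) *
      fun z : Space n => ENNReal.ofReal (Real.exp (c + θ * ‖z‖ ^ 2))) z =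
      ENNReal.ofReal ((2 * Real.pi * σ ^ 2) ^ (-((n : ℝ) / 2)) * Real.exp c *
        Real.exp (-b * ‖z‖ ^ 2)) := by
    intro z
    rw [Pi.mul_apply, ← ENNReal.ofReal_mul' (Real.exp_pos _).le, noiseDensity, mul_assoc,
      mul_assoc (_ ^ (_ : ℝ)) (Real.exp c), ← Real.exp_add, ← Real.exp_add]
    congr 3
    rw [hb_def]
    field_simp
    ring
  rw [lintegral_congr hpt, ← ofReal_integral_eq_lintegral_ofReal (hI.const_mul _)
    (ae_of_all _ fun z => by positivity), integral_const_mul, hint]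
  congr 1
  have hq : Real.pi / b = 2 * Real.pi * σ ^ 2 / (1 - 2 * σ ^ 2 * θ) := by
    rw [hb_def]
    field_simp
  rw [hq, Real.rpow_def_of_pos (by positivity), Real.rpow_def_of_pos (by positivity),
    ← Real.exp_add, ← Real.exp_add, Real.log_div (by positivity) hd.ne']
  congr 1
  ring

theorem isProbabilityMeasure_noise (hσ : 0 < σ) : IsProbabilityMeasure (noise n σ) :=
  ⟨by simpa using lintegral_noise_exp (n := n) hσ 0 (θ := 0) (by simp)⟩

theorem noise_preimage_isometry (e : Space n ≃ₗᵢ[ℝ] Space n) {A : Set (Space n)}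
    (hA : MeasurableSet A) : noise n σ (e ⁻¹' A) = noise n σ A := by
  rw [noise, withDensity_apply _ hA, withDensity_apply _ (e.continuous.measurable hA),
    ← e.measurePreserving.setLIntegral_comp_preimage hA (by fun_prop)]
  simp [noiseDensity]

/-- The volume of the unit ball is at most `(2πe/n)^{n/2}`, in logarithmic form. -/
theorem log_unitBallVolume_le (hn : 1 ≤ n) :
    Real.log (unitBallVolume n) ≤ n / 2 * (Real.log (2 * Real.pi) + 1 - Real.log n) := by
  have hn' : (0 : ℝ) < n := by positivity
  have hV := unitBallVolume_pos n
  have := isProbabilityMeasure_noise (n := n) one_pos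
  have hc : 0 < (2 * Real.pi) ^ (-((n : ℝ) / 2)) * Real.exp (-n / 2) := by positivity
  -- On the ball of radius `√n` the standard Gaussian density is at least its boundary value, and
  -- its total mass is 1. The radius `√n` maximizes `t^n e^{-t²/2}`.
  have h1 : ENNReal.ofReal ((2 * Real.pi) ^ (-((n : ℝ) / 2)) * Real.exp (-n / 2)) *
      volume (Metric.closedBall (0 : Space n) (√n)) ≤ 1 := by
    calc _ = ∫⁻ _ in Metric.closedBall (0 : Space n) (√n),
          ENNReal.ofReal ((2 * Real.pi) ^ (-((n : ℝ) / 2)) * Real.exp (-n / 2)) := by simp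
      _ ≤ ∫⁻ z in Metric.closedBall (0 : Space n) (√n),
          ENNReal.ofReal (noiseDensity n 1 z) := by
          refine setLIntegral_mono (by fun_prop) fun z hz => ENNReal.ofReal_le_ofReal ?_
          have hz' : ‖z‖ ^ 2 ≤ n := by
            rw [← Real.sq_sqrt hn'.le]
            have : ‖z‖ ≤ √n := by simpa using hz
            gcongr
          rw [noiseDensity]
          simp only [one_pow, mul_one]
          gcongr
      _ = noise n 1 (Metric.closedBall (0 : Space n) (√n)) := by
          rw [noise, withDensity_apply _ Metric.isClosed_closedBall.measurableSet]
      _ ≤ 1 := prob_le_one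
  rw [volume_closedBall _ (Real.sqrt_nonneg _), ← ENNReal.ofReal_mul hc.le,
    ENNReal.ofReal_le_one] at h1
  have h2 := Real.log_nonpos (by positivity) h1
  rw [Real.log_mul hc.ne' (by positivity), Real.log_mul (by positivity) (by positivity),
    Real.log_mul hV.ne' (by positivity), Real.log_exp, Real.log_rpow (by positivity),
    Real.log_pow, Real.log_sqrt hn'.le] at h2
  linarith

/-! ### Pairwise error events -/

/-- The noise vectors of norm at most `a` that are at least as close to `x` as to the origin. -/
def pairwiseError (a : ℝ) (x : Space n) : Set (Space n) := {z | ‖z‖ ≤ a ∧ ‖z - x‖ ≤ ‖z‖}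

theorem measurableSet_pairwiseError (a : ℝ) (x : Space n) :
    MeasurableSet (pairwiseError a x) :=
  (isClosed_le continuous_norm continuous_const).measurableSet.inter
    (isClosed_le (by fun_prop) continuous_norm).measurableSet

theorem pairwiseError_eq_empty {a : ℝ} {x : Space n} (h : 2 * a < ‖x‖) :
    pairwiseError a x = ∅ := by
  refine eq_empty_of_forall_notMem fun z hz => ?_
  have := norm_sub_norm_le x (x - z)
  rw [sub_sub_cancel, norm_sub_rev] at this
  linarith [hz.1, hz.2]

/-- Convexity of `c ↦ ‖z - c • y‖`, whose values at both endpoints are at most `‖z‖`. -/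
theorem pairwiseError_subset_smul (a : ℝ) (y : Space n) {c : ℝ} (hc : c ∈ Icc 0 1) :
    pairwiseError a y ⊆ pairwiseError a (c • y) := by
  refine fun z hz => ⟨hz.1, ?_⟩
  have h1 := hc.1
  have h2 := sub_nonneg.2 hc.2
  calc ‖z - c • y‖ = ‖(1 - c) • z + c • (z - y)‖ := by
        congr 1
        module
    _ ≤ (1 - c) * ‖z‖ + c * ‖z - y‖ := by
        refine (norm_add_le _ _).trans ?_
        rw [norm_smul, norm_smul, Real.norm_of_nonneg h1, Real.norm_of_nonneg h2]
    _ ≤ (1 - c) * ‖z‖ + c * ‖z‖ := by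
        have := hz.2
        gcongr
    _ = ‖z‖ := by ring

/-- The reflection in the hyperplane orthogonal to `x - y` maps `x` to `y` and preserves the noise.
-/
theorem noise_pairwiseError_of_norm_eq (a : ℝ) {x y : Space n} (h : ‖x‖ = ‖y‖) :
    noise n σ (pairwiseError a x) = noise n σ (pairwiseError a y) := by
  let e := (ℝ ∙ (x - y))ᗮ.reflection
  have he : e x = y := Submodule.reflection_sub h
  rw [← noise_preimage_isometry e (measurableSet_pairwiseError a y)]
  congr 1
  ext z
  simp [pairwiseError, ← he, ← map_sub]

theorem noise_pairwiseError_anti (a : ℝ) {x y : Space n} (h : ‖x‖ ≤ ‖y‖) :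
    noise n σ (pairwiseError a y) ≤ noise n σ (pairwiseError a x) := by
  have hc : ‖x‖ / ‖y‖ ∈ Icc (0 : ℝ) 1 := ⟨by positivity, div_le_one_of_le₀ h (norm_nonneg _)⟩
  refine (measure_mono (pairwiseError_subset_smul a y hc)).trans
    (noise_pairwiseError_of_norm_eq a ?_).le
  rw [norm_smul, Real.norm_of_nonneg hc.1]
  rcases eq_or_ne ‖y‖ 0 with hy | hy
  · rw [hy] at h ⊢
    simpa using (le_antisymm h (norm_nonneg _)).symm
  · exact div_mul_cancel₀ _ hy

theorem measurableSet_pairwiseError_prod (a : ℝ) :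
    MeasurableSet {p : Space n × Space n | p.2 ∈ pairwiseError a p.1} := by
  have h1 : IsClosed {p : Space n × Space n | ‖p.2‖ ≤ a} :=
    isClosed_le (by fun_prop) continuous_const
  have h2 : IsClosed {p : Space n × Space n | ‖p.2 - p.1‖ ≤ ‖p.2‖} :=
    isClosed_le (by fun_prop) (by fun_prop)
  exact h1.measurableSet.inter h2.measurableSet

theorem measurable_noise_pairwiseError (hσ : 0 < σ) (a : ℝ) :
    Measurable fun x : Space n => noise n σ (pairwiseError a x) :=
  have := isProbabilityMeasure_noise (n := n) hσ
  measurable_measure_prodMk_left (measurableSet_pairwiseError_prod a)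

/-- Fubini: for fixed `z` with `‖z‖ ≤ a`, the admissible `x` fill the closed ball of radius `‖z‖`
about `z`. -/
theorem lintegral_noise_pairwiseError (hσ : 0 < σ) (a : ℝ) :
    ∫⁻ x : Space n, noise n σ (pairwiseError a x) =
      ∫⁻ z in Metric.closedBall 0 a, ENNReal.ofReal (unitBallVolume n * ‖z‖ ^ n) ∂(noise n σ) := by
  have := isProbabilityMeasure_noise (n := n) hσ
  have h := measurableSet_pairwiseError_prod (n := n) a
  have h1 := Measure.prod_apply (μ := (volume : Measure (Space n))) (ν := noise n σ) h
  rw [Measure.prod_apply_symm h] at h1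
  refine h1.symm.trans ?_
  rw [← lintegral_indicator Metric.isClosed_closedBall.measurableSet]
  refine lintegral_congr fun z => ?_
  by_cases hz : ‖z‖ ≤ a
  · rw [indicator_of_mem (by simpa using hz), ← volume_closedBall z (norm_nonneg z)]
    congr 1
    ext x
    simp [pairwiseError, hz, dist_eq_norm, norm_sub_rev x z]
  · rw [indicator_of_notMem (by simpa using hz)]
    simp [pairwiseError, hz]

end Noise

/-- Comparison of integrals from a comparison of superlevel sets. -/
theorem lintegral_le_mul_of_superlevel {X : Type*} [MeasurableSpace X] {μ ν : Measure X}
    {K : ℝ≥0∞} (hK : K ≠ ∞) {f : X → ℝ≥0∞} (hf : Measurable f) (hf' : ∀ x, f x ≠ ∞)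
    (h : ∀ t > 0, ν {x | t < (f x).toReal} ≤ K * μ {x | t < (f x).toReal}) :
    ∫⁻ x, f x ∂ν ≤ K * ∫⁻ x, f x ∂μ := by
  -- Layer-cake formula.
  have key : ∀ m : Measure X,
      ∫⁻ x, f x ∂m = ∫⁻ t in Ioi 0, m {x | t < (f x).toReal} := fun m => by
    rw [← lintegral_eq_lintegral_meas_lt m (ae_of_all _ fun _ => ENNReal.toReal_nonneg)
      hf.ennreal_toReal.aemeasurable]
    exact lintegral_congr fun x => (ENNReal.ofReal_toReal (hf' x)).symm
  rw [key, key, ← lintegral_const_mul' _ _ hK]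
  exact setLIntegral_mono' measurableSet_Ioi fun t ht => h t ht

/-! ### The union bound -/

section UnionBound

variable {n : ℕ} {σ : ℝ} (L : Submodule ℤ (Space n))

theorem countable_lattice [DiscreteTopology L] : Countable L :=
  TopologicalSpace.separableSpace_iff_countable.1 inferInstance

/-- By monotonicity in the norm, a superlevel set containing a farthest lattice point `w` contains
the whole ball of radius `‖w‖`, whose volume controls the count. -/
theorem sum_noise_pairwiseError_le [DiscreteTopology L] (hσ : 0 < σ) {a r A : ℝ} (har : a ≤ r)
    (hA : 0 ≤ A)
    (h : ∀ s ∈ Ioc 0 (2 * r), ((nonzeroBall L s).encard : ℝ≥0∞) ≤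
      ENNReal.ofReal (A * unitBallVolume n * s ^ n)) :
    ∑' v : {v : Space n | v ∈ L ∧ v ≠ 0}, noise n σ (pairwiseError a (v : Space n)) ≤
      ENNReal.ofReal A * ∫⁻ x : Space n, noise n σ (pairwiseError a x) := by
  have := isProbabilityMeasure_noise (n := n) hσ
  let S : Set (Space n) := {v | v ∈ L ∧ v ≠ 0}
  let ν : Measure (Space n) := Measure.sum fun v : S => Measure.dirac (v : Space n)
  let H : Space n → ℝ≥0∞ := fun x => noise n σ (pairwiseError a x)
  have hH : Measurable H := measurable_noise_pairwiseError hσ a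
  have hν : ∀ T, MeasurableSet T → ν T = ((S ∩ T).encard : ℝ≥0∞) := by
    intro T hT
    have : ∀ v : S, Measure.dirac (v : Space n) T = T.indicator 1 (v : Space n) :=
      fun v => Measure.dirac_apply' _ hT
    rw [Measure.sum_apply _ hT, tsum_congr this, tsum_subtype S (T.indicator 1),
      ← ENNReal.tsum_set_one, tsum_subtype (S ∩ T) fun _ => (1 : ℝ≥0∞), indicator_indicator]
    rfl
  have hsum : ∑' v : S, H v = ∫⁻ x, H x ∂ν := by
    rw [lintegral_sum_measure]
    exact tsum_congr fun v => (lintegral_dirac' _ hH).symm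
  refine hsum.trans_le (lintegral_le_mul_of_superlevel ENNReal.ofReal_ne_top hH
    (fun x => measure_ne_top _ _) fun t ht => ?_)
  have hT : MeasurableSet {x | t < (H x).toReal} :=
    measurableSet_lt measurable_const hH.ennreal_toReal
  rw [hν _ hT]
  have hsub : S ∩ {x | t < (H x).toReal} ⊆ nonzeroBall L (2 * r) := by
    rintro v ⟨hv, hvt : t < (H v).toReal⟩
    refine ⟨hv.1, hv.2, ?_⟩
    by_contra! hlt
    have : H v = 0 := by
      simp only [H]
      rw [pairwiseError_eq_empty (by linarith), measure_empty]
    rw [this] at hvt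
    simp at hvt
    linarith
  rcases (S ∩ {x | t < (H x).toReal}).eq_empty_or_nonempty with he | hne
  · simp [he]
  obtain ⟨w, hw, hmax⟩ := exists_max_image _ (fun v : Space n => ‖v‖)
    ((finite_nonzeroBall L (2 * r)).subset hsub) hne
  have hw2 := hsub hw
  calc ((S ∩ {x | t < (H x).toReal}).encard : ℝ≥0∞)
      ≤ ((nonzeroBall L ‖w‖).encard : ℝ≥0∞) := by
        have : S ∩ {x | t < (H x).toReal} ⊆ nonzeroBall L ‖w‖ :=
          fun v hv => ⟨hv.1.1, hv.1.2, hmax v hv⟩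
        exact_mod_cast encard_le_encard this
    _ ≤ ENNReal.ofReal (A * unitBallVolume n * ‖w‖ ^ n) :=
        h _ ⟨norm_pos_iff.2 hw2.2.1, hw2.2.2⟩
    _ = ENNReal.ofReal A * volume (Metric.closedBall (0 : Space n) ‖w‖) := by
        rw [mul_assoc, ENNReal.ofReal_mul hA, volume_closedBall _ (norm_nonneg w)]
    _ ≤ _ := by
        gcongr
        intro x hx
        have hxw : ‖x‖ ≤ ‖w‖ := by simpa using hx
        exact lt_of_lt_of_le hw.2 (ENNReal.toReal_mono (measure_ne_top _ _)
          (noise_pairwiseError_anti a hxw))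

theorem errorProb_le_add_tsum [DiscreteTopology L] (hσ : 0 < σ) (a : ℝ) {D : Space n → Space n}
    (hD : IsMLDecoder L σ D) {x : Space n} (hx : x ∈ L) :
    errorProb σ D x ≤ noise n σ (Metric.closedBall 0 a)ᶜ +
      ∑' v : {v : Space n | v ∈ L ∧ v ≠ 0}, noise n σ (pairwiseError a (v : Space n)) := by
  have : Countable {v : Space n | v ∈ L ∧ v ≠ 0} :=
    ((countable_lattice L).to_set (s := (L : Set (Space n)))).mono fun v hv => hv.1
  have hsub : {z | D (x + z) ≠ x} ⊆ (Metric.closedBall 0 a)ᶜ ∪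
      ⋃ v : {v : Space n | v ∈ L ∧ v ≠ 0}, pairwiseError a (v : Space n) := by
    intro z hz
    by_cases hza : ‖z‖ ≤ a
    -- The difference between the decoded and the transmitted point is the competitor of the origin.
    · refine Or.inr (mem_iUnion.2 ⟨⟨D (x + z) - x, L.sub_mem (hD _).1 hx, sub_ne_zero.2 hz⟩,
        hza, ?_⟩)
      have h := (hD (x + z)).2 x hx
      rw [noiseDensity_le_iff hσ, add_sub_cancel_left] at h
      convert h using 2
      simp only
      abel
    · exact Or.inl (by simpa using hza)
  exact (measure_mono hsub).trans ((measure_union_le _ _).trans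
    (add_le_add_right (measure_iUnion_le _) _))

/-- The union bound for any majorant of the two terms of the integrand. -/
theorem errorProb_le_lintegral [DiscreteTopology L] (hσ : 0 < σ) {a r A : ℝ} (har : a ≤ r)
    (hA : 0 ≤ A)
    (h : ∀ s ∈ Ioc 0 (2 * r), ((nonzeroBall L s).encard : ℝ≥0∞) ≤
      ENNReal.ofReal (A * unitBallVolume n * s ^ n))
    {F : Space n → ℝ} (hF1 : ∀ z, a < ‖z‖ → 1 ≤ F z)
    (hF2 : ∀ z, ‖z‖ ≤ a → A * unitBallVolume n * ‖z‖ ^ n ≤ F z)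
    {D : Space n → Space n} (hD : IsMLDecoder L σ D) {x : Space n} (hx : x ∈ L) :
    errorProb σ D x ≤ ∫⁻ z, ENNReal.ofReal (F z) ∂(noise n σ) := by
  have hB : MeasurableSet (Metric.closedBall (0 : Space n) a) :=
    Metric.isClosed_closedBall.measurableSet
  have hsum := sum_noise_pairwiseError_le L hσ har hA h
  rw [lintegral_noise_pairwiseError hσ, ← lintegral_const_mul' _ _ ENNReal.ofReal_ne_top] at hsum
  refine (errorProb_le_add_tsum L hσ a hD hx).trans ?_
  rw [← lintegral_add_compl _ hB, add_comm]
  refine add_le_add (hsum.trans (setLIntegral_mono' hB fun z hz => ?_)) ?_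
  · rw [← ENNReal.ofReal_mul hA, ← mul_assoc]
    exact ENNReal.ofReal_le_ofReal (hF2 z (by simpa using hz))
  · rw [← setLIntegral_one]
    refine setLIntegral_mono' hB.compl fun z hz => ?_
    rw [ENNReal.one_le_ofReal]
    exact hF1 z (by simpa using hz)

end UnionBound

end LatticeAWGN

namespace LatticeAWGN

/-! ### Radii that minimize the bound -/

section Radius

variable {n : ℕ} {σ : ℝ} (L : Submodule ℤ (Space n))

theorem isProbabilityMeasure_noiseNorm (hσ : 0 < σ) : IsProbabilityMeasure (noiseNorm n σ) :=
  have := isProbabilityMeasure_noise (n := n) hσ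
  Measure.isProbabilityMeasure_map measurable_norm.aemeasurable

theorem noiseNorm_Ioc_pos (hn : 1 ≤ n) (hσ : 0 < σ) {a b : ℝ} (ha : 0 ≤ a) (hab : a < b) :
    0 < (noiseNorm n σ).real (Ioc a b) := by
  have := isProbabilityMeasure_noiseNorm (n := n) hσ
  refine ENNReal.toReal_pos (fun h => ?_) (measure_ne_top _ _)
  rw [noiseNorm, Measure.map_apply measurable_norm measurableSet_Ioc] at h
  -- The noise density is positive everywhere, so a noise-null shell would be Lebesgue-null, yet its
  -- interior is open and nonempty.
  have hac : (volume : Measure (Space n)) ≪ noise n σ :=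
    withDensity_absolutelyContinuous' (by fun_prop) (ae_of_all _ fun z => by
      have : 0 < noiseDensity n σ z := by
        unfold noiseDensity
        positivity
      simpa using this)
  have h0 := measure_mono_null (preimage_mono Ioo_subset_Ioc_self) (hac h)
  have hopen : IsOpen ((fun z : Space n => ‖z‖) ⁻¹' Ioo a b) := isOpen_Ioo.preimage continuous_norm
  refine (hopen.measure_pos volume
    ⟨EuclideanSpace.single ⟨0, by omega⟩ ((a + b) / 2), ?_⟩).ne' h0
  have hm : 0 ≤ (a + b) / 2 := by linarith
  simp only [mem_preimage, PiLp.norm_single, Real.norm_of_nonneg hm]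
  constructor <;> linarith

/-- If `K r^n < 1`, some `r' > r` still has `K r'^n < 1` with no lattice point entering the ball of
radius `2r'`. The factor does not increase, and the shell `(r, r']`, of positive noise mass, now
costs at most `K r'^n` times that mass instead of the full mass. -/
theorem one_le_of_isMinOn_dmhsBound [DiscreteTopology L] [IsZLattice ℝ L] (hn : 1 ≤ n)
    (hσ : 0 < σ) {r : ℝ} (hr : 0 < r) (hmin : IsMinOn (dmhsBound L σ) (Ioi 0) r) :
    1 ≤ dmhsFactor L r * density L * unitBallVolume n * r ^ n := by
  have := isProbabilityMeasure_noiseNorm (n := n) hσ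
  have hV := unitBallVolume_pos n
  have hβ := density_pos L
  have hα := dmhsFactor_nonneg L hr
  by_contra! hlt
  set K := dmhsFactor L r * density L * unitBallVolume n with hK
  have hK0 : 0 ≤ K := by positivity
  obtain ⟨t, ht, hgap⟩ := exists_nonzeroBall_gap L (2 * r)
  obtain ⟨r', hr'K, hr't, hrr'⟩ : ∃ r', K * r' ^ n < 1 ∧ r' < t / 2 ∧ r < r' := by
    have h1 : ∀ᶠ x in 𝓝[>] r, K * x ^ n < 1 :=
      nhdsWithin_le_nhds ((Continuous.tendsto (by fun_prop) r).eventually_lt_const hlt)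
    have h2 : ∀ᶠ x in 𝓝[>] r, x < t / 2 :=
      nhdsWithin_le_nhds (Iio_mem_nhds (by linarith [show 2 * r < t from ht]))
    exact (h1.and (h2.and self_mem_nhdsWithin)).exists
  have hr' : 0 < r' := hr.trans hrr'
  have hα' : dmhsFactor L r' ≤ dmhsFactor L r :=
    dmhsFactor_le_of_nonzeroBall_eq L hn hr hrr'.le <|
      Subset.antisymm ((nonzeroBall_mono L (by linarith)).trans hgap.subset)
        (nonzeroBall_mono L (by linarith))
  have hint : ∀ a b : ℝ, IntegrableOn (fun ρ : ℝ => ρ ^ n) (Ioc a b) (noiseNorm n σ) := fun a b =>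
    (Continuous.integrableOn_Icc (by fun_prop)).mono_set Ioc_subset_Icc_self
  have hsplit : ∫ ρ in Ioc 0 r', ρ ^ n ∂(noiseNorm n σ) =
      (∫ ρ in Ioc 0 r, ρ ^ n ∂(noiseNorm n σ)) + ∫ ρ in Ioc r r', ρ ^ n ∂(noiseNorm n σ) := by
    rw [← Ioc_union_Ioc_eq_Ioc hr.le hrr'.le,
      setIntegral_union (Ioc_disjoint_Ioc_of_le le_rfl) measurableSet_Ioc (hint _ _) (hint _ _)]
  have htail : (noiseNorm n σ).real (Ioi r) =
      (noiseNorm n σ).real (Ioc r r') + (noiseNorm n σ).real (Ioi r') := by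
    rw [← Ioc_union_Ioi_eq_Ioi hrr'.le, measureReal_union
      (Ioc_disjoint_Ioi le_rfl) measurableSet_Ioi]
  have hmid : ∫ ρ in Ioc r r', ρ ^ n ∂(noiseNorm n σ) ≤
      r' ^ n * (noiseNorm n σ).real (Ioc r r') := by
    calc _ ≤ ∫ _ in Ioc r r', r' ^ n ∂(noiseNorm n σ) := by
          refine setIntegral_mono_on (hint _ _) (integrable_const _) measurableSet_Ioc
            fun ρ hρ => ?_
          exact pow_le_pow_left₀ (hr.trans hρ.1).le hρ.2 n
      _ = _ := by simp [mul_comm]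
  have hI : 0 ≤ ∫ ρ in Ioc 0 r', ρ ^ n ∂(noiseNorm n σ) :=
    setIntegral_nonneg measurableSet_Ioc fun ρ hρ => pow_nonneg hρ.1.le n
  have hpos := noiseNorm_Ioc_pos hn hσ hr.le hrr'
  have hle : dmhsBound L σ r ≤ dmhsBound L σ r' := hmin (mem_Ioi.2 hr')
  have hle' : dmhsBound L σ r' ≤ K * (∫ ρ in Ioc 0 r', ρ ^ n ∂(noiseNorm n σ)) +
      (noiseNorm n σ).real (Ioi r') := by
    rw [dmhsBound, hK]
    gcongr
  rw [hsplit] at hle'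
  rw [dmhsBound, ← hK, htail] at hle
  nlinarith [mul_le_mul_of_nonneg_left hmid hK0]

end Radius

/-! ### The exponent -/

theorem deltaStar_eq {σ : ℝ} (hσ : 0 < σ) :
    deltaStar σ = -(1 / 2) * (Real.log (2 * Real.pi) + 1 + 2 * Real.log σ) := by
  rw [deltaStar, one_div (_ * _), Real.log_inv, Real.log_mul (by positivity) (by positivity),
    Real.log_mul (by positivity) (by positivity), Real.log_exp, Real.log_pow]
  push_cast
  ring

theorem deltaCr_eq {σ : ℝ} (hσ : 0 < σ) : deltaCr σ = deltaStar σ - Real.log 2 / 2 := by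
  have : 4 * Real.pi * Real.exp 1 * σ ^ 2 = 2 * (2 * Real.pi * Real.exp 1 * σ ^ 2) := by ring
  rw [deltaCr, deltaStar, this, one_div (_ * _), one_div (_ * _), Real.log_inv, Real.log_inv,
    Real.log_mul two_ne_zero (by positivity)]
  ring

/-- The right side is concave in `s` with critical point `e^{2(δ* - δ)} - 1`; clipping this to
`[0,1]` gives the three cases of `E_r`. -/
theorem exists_randomCodingExponent_eq {σ : ℝ} (hσ : 0 < σ) (δ : ℝ) :
    ∃ s ∈ Icc (0 : ℝ) 1, randomCodingExponent σ δ =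
      s / 2 - (1 + s) / 2 * Real.log (1 + s) + s * (deltaStar σ - δ) := by
  rw [randomCodingExponent, deltaCr_eq hσ]
  split_ifs with h1 h2
  · refine ⟨1, by simp, ?_⟩
    rw [Real.log_div (by positivity) (by norm_num), Real.log_exp,
      show (4 : ℝ) = 2 ^ 2 by norm_num, Real.log_pow]
    norm_num
    ring
  · refine ⟨Real.exp (2 * (deltaStar σ - δ)) - 1, ⟨?_, ?_⟩, ?_⟩
    · linarith [Real.one_le_exp (show 0 ≤ 2 * (deltaStar σ - δ) by linarith)]
    · have : Real.exp (2 * (deltaStar σ - δ)) ≤ Real.exp (Real.log 2) :=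
        Real.exp_le_exp.2 (by linarith)
      rw [Real.exp_log two_pos] at this
      linarith
    · rw [add_sub_cancel, Real.log_exp]
      ring
  · exact ⟨0, by simp, by simp⟩

/-- The tilted majorant of `min 1 ((t / a) ^ n)`. -/
theorem log_majorant {n σ a s t : ℝ} (hn : 0 < n) (hσ : 0 < σ) (ht : 0 < t)
    (hs : 0 ≤ s) :
    n * s * (Real.log t - Real.log a) ≤
      n * s / 2 * (Real.log (1 + s) - 1 - (2 * Real.log a - Real.log n - 2 * Real.log σ)) +
        s / (2 * (1 + s) * σ ^ 2) * t ^ 2 := by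
  have hs1 : 0 < 1 + s := by linarith
  -- Tangent to the logarithm at `t² = nσ²(1+s)`, the mean squared norm under the tilted Gaussian of
  -- variance `σ²(1+s)`.
  have h := Real.log_le_sub_one_of_pos (show 0 < t ^ 2 / (n * σ ^ 2 * (1 + s)) by positivity)
  rw [Real.log_div (by positivity) (by positivity), Real.log_mul (by positivity) hs1.ne',
    Real.log_mul hn.ne' (by positivity), Real.log_pow, Real.log_pow] at h
  have h' := mul_le_mul_of_nonneg_left h (show 0 ≤ n * s / 2 by positivity)
  have he : n * s / 2 * (t ^ 2 / (n * σ ^ 2 * (1 + s))) =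
      s / (2 * (1 + s) * σ ^ 2) * t ^ 2 := by
    field_simp
  rw [mul_sub _ (t ^ 2 / _), he] at h'
  push_cast at h'
  linarith

/-- The error probability at a radius `r` with `α β V_n r ^ n ≥ 1`, for every dimension. -/
theorem errorProb_le_exp {n : ℕ} {σ : ℝ} (L : Submodule ℤ (Space n)) [DiscreteTopology L]
    [IsZLattice ℝ L] (hn : 1 ≤ n) (hσ : 0 < σ) {r : ℝ} (hr : 0 < r)
    (hr1 : 1 ≤ dmhsFactor L r * density L * unitBallVolume n * r ^ n)
    {D : Space n → Space n} (hD : IsMLDecoder L σ D) {x : Space n} (hx : x ∈ L) :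
    errorProb σ D x ≤ ENNReal.ofReal (Real.exp (-(n *
      randomCodingExponent σ (nld L + 1 / n * Real.log (dmhsFactor L r))))) := by
  have hn' : (0 : ℝ) < n := by positivity
  have hV := unitBallVolume_pos n
  have hβ := density_pos L
  have hα : 0 < dmhsFactor L r := by
    refine (dmhsFactor_nonneg L hr).lt_of_ne fun h => ?_
    rw [← h] at hr1
    norm_num at hr1
  set α := dmhsFactor L r
  set K := α * density L * unitBallVolume n with hK
  have hK0 : 0 < K := by positivity
  -- The noise is truncated where `K t^n` crosses 1, while the factor stays the one at `r`; this is
  -- legitimate because `a ≤ r`.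
  obtain ⟨a, ha, haK⟩ : ∃ a : ℝ, 0 < a ∧ K * a ^ n = 1 :=
    ⟨(K⁻¹) ^ ((n : ℝ)⁻¹), by positivity, by
      rw [Real.rpow_inv_natCast_pow (by positivity) (by omega), mul_inv_cancel₀ hK0.ne']⟩
  have har : a ≤ r := by
    refine le_of_pow_le_pow_left₀ (by omega : n ≠ 0) hr.le (le_of_mul_le_mul_left ?_ hK0)
    rwa [haK]
  have hlogK : Real.log K + n * Real.log a = 0 := by
    rw [← Real.log_pow, ← Real.log_mul hK0.ne' (by positivity), haK, Real.log_one]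
  obtain ⟨s, ⟨hs0, hs1⟩, hE⟩ :=
    exists_randomCodingExponent_eq hσ (nld L + 1 / n * Real.log α)
  set c := n * s / 2 * (Real.log (1 + s) - 1 - (2 * Real.log a - Real.log n - 2 * Real.log σ))
    with hc
  have hmaj : ∀ t : ℝ, 0 < t → n * s * (Real.log t - Real.log a) ≤
      c + s / (2 * (1 + s) * σ ^ 2) * t ^ 2 := fun t ht => log_majorant hn' hσ ht hs0
  have hθ : 2 * σ ^ 2 * (s / (2 * (1 + s) * σ ^ 2)) = s / (1 + s) := by
    field_simp
  have hθ' : 1 - s / (1 + s) = (1 + s)⁻¹ := by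
    field_simp
    ring
  have hF1 : ∀ z : Space n, a < ‖z‖ →
      1 ≤ Real.exp (c + s / (2 * (1 + s) * σ ^ 2) * ‖z‖ ^ 2) := by
    intro z hz
    have hlog := Real.log_le_log ha hz.le
    refine Real.one_le_exp (le_trans ?_ (hmaj _ (ha.trans hz)))
    exact mul_nonneg (by positivity) (by linarith)
  have hF2 : ∀ z : Space n, ‖z‖ ≤ a → α * density L * unitBallVolume n * ‖z‖ ^ n ≤
      Real.exp (c + s / (2 * (1 + s) * σ ^ 2) * ‖z‖ ^ 2) := by
    intro z hz
    rcases (norm_nonneg z).eq_or_lt with h0 | h0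
    · rw [← h0, zero_pow (by omega), mul_zero]
      positivity
    · have hlog := Real.log_le_log h0 hz
      rw [← hK, ← Real.log_le_iff_le_exp (by positivity), Real.log_mul hK0.ne' (by positivity),
        Real.log_pow]
      refine le_trans ?_ (hmaj _ h0)
      -- For `t ≤ a` and `s ≤ 1`, `K t^n = (t/a)^n ≤ (t/a)^{ns}`.
      nlinarith [mul_nonneg (mul_nonneg hn'.le (sub_nonneg.2 hs1)) (sub_nonneg.2 hlog)]
  refine (errorProb_le_lintegral L hσ har (A := α * density L) (by positivity)
    (fun t ht => encard_nonzeroBall_le L hn ht) hF1 hF2 hD hx).trans ?_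
  rw [lintegral_noise_exp hσ _ (by rw [hθ, div_lt_one (by linarith)]; linarith), hθ, hθ',
    Real.log_inv]
  refine ENNReal.ofReal_le_ofReal (Real.exp_le_exp.2 ?_)
  have hVle := log_unitBallVolume_le hn
  have hlogβ : n * nld L = Real.log (density L) := by
    rw [nld]
    field_simp
  have hlogα : n * (1 / n * Real.log α) = Real.log α := by
    field_simp
  rw [hK, Real.log_mul (by positivity) hV.ne', Real.log_mul hα.ne' hβ.ne'] at hlogK
  -- The bound on `V_n` enters here, through `log a = -(log K)/n`.
  have hkey : n * (deltaStar σ - (nld L + 1 / n * Real.log α)) ≤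
      n / 2 * (2 * Real.log a - Real.log n - 2 * Real.log σ) := by
    rw [mul_sub, mul_add, hlogβ, hlogα, deltaStar_eq hσ]
    linarith
  have hkey' := mul_le_mul_of_nonneg_left hkey hs0
  rw [hE, hc]
  linarith

end LatticeAWGN

open LatticeAWGN in
theorem mainTheorem1 (σ : ℝ) (hσ : 0 < σ)
    (L : (n : ℕ) → Submodule ℤ (EuclideanSpace ℝ (Fin n)))
    [∀ n, DiscreteTopology (L n)] [∀ n, IsZLattice ℝ (L n)]
    (r : ℕ → ℝ) (hr : ∀ n, 1 ≤ n → IsDMHSRadius (L n) σ (r n))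
    (α ν : ℕ → ℝ) (hα : ∀ n, α n = dmhsFactor (L n) (r n))
    (hν : ∀ n, ν n = 1 / (n : ℝ) * Real.log (α n)) :
    ∃ o : ℕ → ℝ, Tendsto o atTop (𝓝 0) ∧
      ∀ n, 1 ≤ n → ∀ D : EuclideanSpace ℝ (Fin n) → EuclideanSpace ℝ (Fin n),
        IsMLDecoder (L n) σ D → ∀ x ∈ L n,
          errorProb σ D x ≤ ENNReal.ofReal
            (Real.exp (-((n : ℝ) * (randomCodingExponent σ (nld (L n) + ν n) + o n)))) := by
  -- The bound `(2πe/n)^{n/2}` on `V_n` holds in every dimension, so no error term is needed.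
  refine ⟨fun _ => 0, tendsto_const_nhds, fun n hn D hD x hx => ?_⟩
  obtain ⟨hr0, hr1⟩ := hr n hn
  rw [add_zero, hν, hα]
  exact errorProb_le_exp (L n) hn hσ hr0
    (hr1.elim (one_le_of_isMinOn_dmhsBound (L n) hn hσ hr0) id) hD hx
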